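/- Let $(\Omega,\mathcal F,\mathbb P)$ be a nonatomic probability space (every event of positive probability contains an event of strictly smaller positive probability), and let $\Phi:[0,\infty)\to[0,\infty)$ be an Orlicz function, i.e. non-constant, convex, nondecreasing, with $\Phi(0)=0$. Let $L^\Phi$ be the set of all real random variables $X$ on $\Omega$ (modulo almost sure equality) whose Luxemburg norm $$\|X\|_\Phi=\inf\Big\{\tfrac1\lambda:\lambda>0,\ \mathbb E[\Phi(\lambda|X|)]\le 1\Big\}\qquad(\inf\emptyset=\infty)$$ is finite. Let $\rho:L^\Phi\to\mathbb R$ be a functional (not assumed linear, convex or monotone) which is - law invariant: $\rho(X)=\rho(Y)$ whenever $X,Y\in L^\Phi$ have the same distribution; and - order continuous: $\rho(X_n)\to\rho(X)$ whenever $X_n,X\in L^\Phi$, $X_n\to X$ a.s., and there is $Y\in L^\Phi$ with $|X_n|\le Y$ a.s. for all $n$. Then $\rho$ is strongly consistent at every $X\in L^\Phi$, in the following sense. Let $(X_n)_{n\ge1}$ be any stationary ergodic sequence of random variables on $\Omega$, each with the same distribution as $X$. Here stationary means that $$\mathbb P(X_1\le x_1,\dots,X_n\le x_n)=\mathbb P(X_{k+1}\le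 x_1,\dots,X_{k+n}\le x_n)$$ for all $k,n\in\mathbb N$ and $x_1,\dots,x_n\in\mathbb R$, and ergodic means that $\mathbb P(A)\in\{0,1\}$ for every event $A$ for which there is a Borel set $B\subset\mathbb R^{\mathbb N}$ with $A=\{(X_n)_{n\ge k}\in B\}$ for every $k\ge1$. For $n\ge 1$ let $\widehat m_n(\omega)=\frac1n\sum_{i=1}^n\delta_{X_i(\omega)}$ be the empirical distributions. Then for every $n\ge1$ and $\omega\in\Omega$, $\widehat m_n(\omega)$ is the distribution of some element of $L^\Phi$, and $$\mathcal R_\rho(\widehat m_n)\to\rho(X)\quad\text{almost surely},$$ where $\mathcal R_\rho$ is the map induced by $\rho$ on the distributions of elements of $L^\Phi$: $\mathcal R_\rho(\mathbb P\circ Z^{-1})=\rho(Z)$ for $Z\in L^\Phi$. -/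

import Mathlib

open MeasureTheory ProbabilityTheory Filter Topology
open scoped NNReal ENNReal

/-- A measure space is nonatomic (atomless): every measurable set of positive measure has a
measurable subset of strictly smaller positive measure. (Mathlib's `NoAtoms` only says that points
are null, which is weaker on general measurable spaces.) -/
def IsNonatomic {Ω : Type*} [MeasurableSpace Ω] (P : Measure Ω) : Prop :=
  ∀ A : Set Ω, MeasurableSet A → 0 < P A →
    ∃ B : Set Ω, MeasurableSet B ∧ B ⊆ A ∧ 0 < P B ∧ P B < P A

/-- Orlicz functions `Φ : [0, ∞) → [0, ∞)`: non-constant, convex, increasing (in the weak sense),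
with `Φ 0 = 0`. -/
structure IsOrliczFunction (Φ : ℝ≥0 → ℝ≥0) : Prop where
  nonconstant : ∃ x y : ℝ≥0, Φ x ≠ Φ y
  convex : ConvexOn ℝ≥0 Set.univ Φ
  mono : Monotone Φ
  map_zero : Φ 0 = 0

section Functionals

variable {Ω : Type*} [MeasurableSpace Ω] (P : Measure Ω)

/-- The Luxemburg norm `inf {1 / l : l > 0, E[Φ(l |X|)] ≤ 1}`, with `inf ∅ = ∞`. -/
noncomputable def luxemburgNorm (Φ : ℝ≥0 → ℝ≥0) (X : Ω →ₘ[P] ℝ) : ℝ≥0∞ :=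
  ⨅ (l : ℝ≥0) (_ : 0 < l ∧ ∫⁻ ω, (Φ (l * ‖X ω‖₊) : ℝ≥0∞) ∂P ≤ 1), (l : ℝ≥0∞)⁻¹

/-- The Orlicz space `L^Φ`, inside the space `L⁰` of random variables modulo a.s. equality. -/
def OrliczSpace (Φ : ℝ≥0 → ℝ≥0) : Set (Ω →ₘ[P] ℝ) :=
  {X | luxemburgNorm P Φ X < ∞}

variable {P} {𝒳 : Set (Ω →ₘ[P] ℝ)}

/-- Order convergence in `𝒳`: almost sure convergence, dominated by an element of `𝒳`. -/
def OrderConverges (Xs : ℕ → 𝒳) (X : 𝒳) : Prop :=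
  (∀ᵐ ω ∂P, Tendsto (fun n => (Xs n).1 ω) atTop (𝓝 (X.1 ω))) ∧
    ∃ Y : 𝒳, ∀ n, ∀ᵐ ω ∂P, |(Xs n).1 ω| ≤ Y.1 ω

/-- Order continuity at `X`. -/
def OrderContinuousAt (ρ : 𝒳 → ℝ) (X : 𝒳) : Prop :=
  ∀ Xs : ℕ → 𝒳, OrderConverges Xs X → Tendsto (fun n => ρ (Xs n)) atTop (𝓝 (ρ X))

/-- Order continuity (the Lebesgue property). -/
def OrderContinuous (ρ : 𝒳 → ℝ) : Prop :=
  ∀ X : 𝒳, OrderContinuousAt ρ X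

/-- Law invariance: the functional takes equal values at random variables with the same law. -/
def LawInvariant (ρ : 𝒳 → ℝ) : Prop :=
  ∀ X Y : 𝒳, P.map X.1 = P.map Y.1 → ρ X = ρ Y

/-- The set of laws of the elements of `𝒳`. -/
def lawsOf (𝒳 : Set (Ω →ₘ[P] ℝ)) : Set (Measure ℝ) :=
  {μ | ∃ X : 𝒳, P.map X.1 = μ}

/-- The map on the set of laws of `𝒳` which a law-invariant functional `ρ` induces:
its value at the law `μ` is `ρ X` for an `X ∈ 𝒳` of law `μ`. -/
noncomputable def inducedMap (ρ : 𝒳 → ℝ) (μ : lawsOf 𝒳) : ℝ :=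
  ρ μ.2.choose

/-- The induced map is well defined by law invariance: its value at the law of `X` is `ρ X`. -/
theorem inducedMap_law {ρ : 𝒳 → ℝ} (hρ : LawInvariant ρ) (X : 𝒳) (μ : lawsOf 𝒳)
    (h : P.map X.1 = μ.1) : inducedMap ρ μ = ρ X :=
  hρ _ _ (μ.2.choose_spec.trans h.symm)

/-- The empirical distribution `(1/n) ∑_{i < n} δ_{X_i}` of the first `n` terms (for `n ≥ 1`). -/
noncomputable def empiricalLaw (Xs : ℕ → Ω → ℝ) (n : ℕ) (ω : Ω) : Measure ℝ :=
  (n : ℝ≥0∞)⁻¹ • ∑ i ∈ Finset.range n, Measure.dirac (Xs i ω)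

/-- The event `A` is invariant for the sequence `Xs`: for one Borel set `B` of sequences,
`A` is the event that `(X_k, X_{k+1}, …) ∈ B`, whatever `k`. -/
def IsInvariantEvent (Xs : ℕ → Ω → ℝ) (A : Set Ω) : Prop :=
  MeasurableSet A ∧
    ∃ B : Set (ℕ → ℝ), MeasurableSet B ∧ ∀ k : ℕ, A = {ω | (fun n => Xs (k + n) ω) ∈ B}

/-- Stationary ergodic sequences of random variables. -/
structure IsStationaryErgodic (P : Measure Ω) (Xs : ℕ → Ω → ℝ) : Prop where
  measurable : ∀ n, Measurable (Xs n)
  stationary : ∀ (k n : ℕ) (x : Fin n → ℝ),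
    P {ω | ∀ i : Fin n, Xs i ω ≤ x i} = P {ω | ∀ i : Fin n, Xs (k + i) ω ≤ x i}
  ergodic : ∀ A : Set Ω, IsInvariantEvent Xs A → P A = 0 ∨ P A = 1

/-- Strong consistency of `ρ` at `X`: for every stationary ergodic sequence of random variables
with the law of `X`, the empirical distributions are laws of elements of `𝒳`, so that the
empirical estimates (the values of the induced map there) make sense, and the estimates converge
almost surely to `ρ X`. -/
def StronglyConsistentAt (ρ : 𝒳 → ℝ) (X : 𝒳) : Prop :=
  ∀ Xs : ℕ → Ω → ℝ, IsStationaryErgodic P Xs → (∀ n, P.map (Xs n) = P.map X.1) →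
    ∃ h : ∀ (n : ℕ) (ω : Ω), empiricalLaw Xs (n + 1) ω ∈ lawsOf 𝒳,
      ∀ᵐ ω ∂P, Tendsto (fun n => inducedMap ρ ⟨empiricalLaw Xs (n + 1) ω, h n ω⟩)
        atTop (𝓝 (ρ X))

end Functionals

/-! Couple all the laws through one uniform variable `U`, which exists because `P` is nonatomic: a
law `μ` is represented by `quantile μ` at `U`. Fix a scale `l` at which `X` has finite modular
`E[Φ(l|X|)]`. By the ergodic theorem, applied to the indicators of `(-∞, q]` for rational `q` and to
`x ↦ Φ(l|x|)`, for almost every sample the empirical distribution functions converge at the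
rationals and the empirical modulars converge. Hence the quantile variables `Zₙ` of the empirical
laws converge almost surely to the quantile variable `Z` of `X`, together with their modulars.

Scheffé's lemma makes `Φ(l|Zₙ|)` converge in mean, so every subsequence has a further one along
which `Φ(l|Zₙ|) ≤ G` with `G` integrable. There `Y = sup |Zₙ|` satisfies `Φ(lY) ≤ G`, so `Y ∈ L^Φ`
dominates and the convergence is in order. Order continuity and the subsequence criterion give
`ρ(Zₙ) → ρ(Z)`, which equals `ρ(X)` by law invariance. One scale suffices, since a finite modular at
some scale already gives membership in `L^Φ`. -/

/-! ### The pointwise ergodic theorem -/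

section PointwiseErgodic

variable {α : Type*}

/-- The maximum of `0` and the first `n` Birkhoff sums of `g`. -/
noncomputable def birkhoffMax (T : α → α) (g : α → ℝ) : ℕ → α → ℝ
  | 0, _ => 0
  | n + 1, x => max 0 (g x + birkhoffMax T g n (T x))

theorem birkhoffMax_nonneg (T : α → α) (g : α → ℝ) (n : ℕ) (x : α) :
    0 ≤ birkhoffMax T g n x := by
  cases n with
  | zero => exact le_rfl
  | succ n => exact le_max_left _ _

theorem birkhoffMax_monotone (T : α → α) (g : α → ℝ) (x : α) :
    Monotone fun n => birkhoffMax T g n x := by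
  refine monotone_nat_of_le_succ fun n => ?_
  induction n generalizing x with
  | zero => exact birkhoffMax_nonneg T g _ x
  | succ n ih =>
    simp only [birkhoffMax] at ih ⊢
    gcongr
    exact ih (T x)

theorem birkhoffSum_le_birkhoffMax (T : α → α) (g : α → ℝ) (n : ℕ) (x : α) :
    birkhoffSum T g n x ≤ birkhoffMax T g n x := by
  induction n generalizing x with
  | zero => simp [birkhoffMax]
  | succ n ih =>
    rw [birkhoffSum_succ', birkhoffMax]
    exact le_max_of_le_right (by gcongr; exact ih (T x))

/-- This makes the set where the maxima stay bounded exactly invariant, so that ergodicity decides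
it. -/
theorem bddAbove_birkhoffMax_comp_iff (T : α → α) (g : α → ℝ) (x : α) :
    BddAbove (Set.range fun n => birkhoffMax T g n (T x)) ↔
      BddAbove (Set.range fun n => birkhoffMax T g n x) := by
  constructor
  · rintro ⟨C, hC⟩
    refine ⟨max 0 (g x + C), ?_⟩
    rintro _ ⟨n, rfl⟩
    refine (birkhoffMax_monotone T g x n.le_succ).trans ?_
    simp only [birkhoffMax]
    gcongr
    exact hC ⟨n, rfl⟩
  · rintro ⟨C, hC⟩
    refine ⟨C - g x, ?_⟩
    rintro _ ⟨n, rfl⟩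
    have h : birkhoffMax T g (n + 1) x ≤ C := hC ⟨n + 1, rfl⟩
    simp only [birkhoffMax, max_le_iff] at h
    linarith [h.2]

variable [MeasurableSpace α] {μ : Measure α} {T : α → α} {g : α → ℝ}

theorem measurable_birkhoffMax (hT : Measurable T) (hg : Measurable g) (n : ℕ) :
    Measurable (birkhoffMax T g n) := by
  induction n with
  | zero => exact measurable_const
  | succ n ih => exact measurable_const.max (hg.add (ih.comp hT))

theorem integrable_birkhoffMax (hT : MeasurePreserving T μ μ) (hg : Integrable g μ) (n : ℕ) :
    Integrable (birkhoffMax T g n) μ := by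
  induction n with
  | zero => exact integrable_zero _ _ _
  | succ n ih =>
    exact (integrable_zero α ℝ μ).sup (hg.add (hT.integrable_comp_of_integrable ih))

/-- For an ergodic transformation, the Birkhoff sums of a function of negative mean are bounded
above almost everywhere. -/
theorem Ergodic.ae_bddAbove_birkhoffSum (hT : Ergodic T μ) (hgm : Measurable g)
    (hg : Integrable g μ) (hneg : ∫ x, g x ∂μ < 0) :
    ∀ᵐ x ∂μ, BddAbove (Set.range fun n => birkhoffSum T g n x) := by
  set A : Set α := {x | BddAbove (Set.range fun n => birkhoffMax T g n x)} with hA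
  have hAm : MeasurableSet A :=
    measurableSet_bddAbove_range fun n => measurable_birkhoffMax hT.measurable hgm n
  have hAT : T ⁻¹' A = A := by
    ext x
    exact bddAbove_birkhoffMax_comp_iff T g x
  rcases hT.toPreErgodic.ae_mem_or_ae_notMem hAm hAT with h | h
  · filter_upwards [h] with x hx
    obtain ⟨C, hC⟩ := hx
    refine ⟨C, ?_⟩
    rintro _ ⟨n, rfl⟩
    exact (birkhoffSum_le_birkhoffMax T g n x).trans (hC ⟨n, rfl⟩)
  · exfalso
    have hint := fun n => integrable_birkhoffMax hT.toMeasurePreserving hg n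
    have hintT := fun n => hT.toMeasurePreserving.integrable_comp_of_integrable (hint n)
    -- With `M n` the maxima, `M (n+1) - M n ∘ T = max (-M n ∘ T) g`. This is at most `|g|` in
    -- absolute value and tends to `g` where `M n ∘ T → ∞`. As `T` preserves `μ` and `M` increases,
    -- its integral is nonnegative, which contradicts the negative mean.
    have hlim : Tendsto (fun n => ∫ x, (birkhoffMax T g (n + 1) x - birkhoffMax T g n (T x)) ∂μ)
        atTop (𝓝 (∫ x, g x ∂μ)) := by
      refine tendsto_integral_of_dominated_convergence (fun x => |g x|)
        (fun n => ((hint (n + 1)).sub (hintT n)).aestronglyMeasurable) hg.abs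
        (fun n => ae_of_all _ fun x => ?_) ?_
      · have h0 := birkhoffMax_nonneg T g n (T x)
        simp only [birkhoffMax, Real.norm_eq_abs]
        rcases max_cases 0 (g x + birkhoffMax T g n (T x)) with ⟨h1, h2⟩ | ⟨h1, h2⟩ <;> rw [h1]
        · rw [abs_le]
          constructor <;> cases abs_cases (g x) <;> linarith
        · simp
      · filter_upwards [h] with x hx
        have hx' : ¬ BddAbove (Set.range fun n => birkhoffMax T g n (T x)) := fun hb =>
          hx ((bddAbove_birkhoffMax_comp_iff T g x).1 hb)
        have htop := tendsto_atTop_atTop_of_monotone (birkhoffMax_monotone T g (T x)) fun b => by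
          by_contra! hb
          exact hx' ⟨b, by rintro _ ⟨n, rfl⟩; exact (hb n).le⟩
        refine tendsto_const_nhds.congr' ?_
        filter_upwards [htop.eventually_ge_atTop (-g x)] with n hn
        rw [birkhoffMax, max_eq_right (by linarith)]
        ring
    refine hneg.not_ge (ge_of_tendsto' hlim fun n => ?_)
    change 0 ≤ ∫ x, (birkhoffMax T g (n + 1) x - (birkhoffMax T g n ∘ T) x) ∂μ
    rw [integral_sub (hint _) (hintT n), sub_nonneg]
    have : ∫ x, birkhoffMax T g n (T x) ∂μ = ∫ x, birkhoffMax T g n x ∂μ := by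
      conv_rhs => rw [← hT.map_eq]
      rw [integral_map hT.measurable.aemeasurable]
      exact (measurable_birkhoffMax hT.measurable hgm n).aestronglyMeasurable
    rw [Function.comp_def, this]
    exact integral_mono (hint n) (hint _) fun x => birkhoffMax_monotone T g x n.le_succ

variable [IsProbabilityMeasure μ]

/-- For `d` strictly between the mean and `c`, the Birkhoff sums of `g - d` are bounded by some `C`,
and `C / n` vanishes in the limit. -/
theorem Ergodic.ae_eventually_birkhoffSum_le (hT : Ergodic T μ) (hgm : Measurable g)
    (hg : Integrable g μ) {c : ℝ} (hc : ∫ x, g x ∂μ < c) :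
    ∀ᵐ x ∂μ, ∀ᶠ n : ℕ in atTop, (n : ℝ)⁻¹ * birkhoffSum T g n x ≤ c := by
  obtain ⟨d, hd, hdc⟩ := exists_between hc
  have h := hT.ae_bddAbove_birkhoffSum (g := fun x => g x - d) (hgm.sub_const d)
    (hg.sub (integrable_const d)) (by
      rw [integral_sub hg (integrable_const d)]
      simpa using hd)
  filter_upwards [h] with x ⟨C, hC⟩
  have hlim : Tendsto (fun n : ℕ => (n : ℝ)⁻¹ * C) atTop (𝓝 (0 * C)) :=
    tendsto_inv_atTop_nhds_zero_nat.mul_const C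
  rw [zero_mul] at hlim
  filter_upwards [hlim.eventually_lt_const (sub_pos.2 hdc), eventually_gt_atTop 0] with n hn hn0
  have h1 : birkhoffSum T (fun x => g x - d) n x ≤ C := hC ⟨n, rfl⟩
  have h2 : birkhoffSum T (fun x => g x - d) n x = birkhoffSum T g n x - n * d := by
    simp [birkhoffSum, Finset.sum_sub_distrib]
  have hn0' : (0 : ℝ) < n := by exact_mod_cast hn0
  have h3 : (n : ℝ)⁻¹ * birkhoffSum T g n x ≤ (n : ℝ)⁻¹ * (C + n * d) := by
    gcongr
    linarith
  have h4 : (n : ℝ)⁻¹ * (C + n * d) = (n : ℝ)⁻¹ * C + d := by field_simp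
  linarith

/-- The pointwise ergodic theorem, for ergodic transformations of a probability space. -/
theorem Ergodic.ae_tendsto_birkhoffSum (hT : Ergodic T μ) (hgm : Measurable g)
    (hg : Integrable g μ) :
    ∀ᵐ x ∂μ, Tendsto (fun n : ℕ => (n : ℝ)⁻¹ * birkhoffSum T g n x) atTop
      (𝓝 (∫ y, g y ∂μ)) := by
  have hpos : ∀ k : ℕ, (0 : ℝ) < 1 / (k + 1) := fun k => Nat.one_div_pos_of_nat
  have hup := ae_all_iff.2 fun k : ℕ => hT.ae_eventually_birkhoffSum_le hgm hg
    (lt_add_of_pos_right (∫ y, g y ∂μ) (hpos k))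
  have hlo := ae_all_iff.2 fun k : ℕ => hT.ae_eventually_birkhoffSum_le hgm.neg hg.neg
    (lt_add_of_pos_right (∫ y, (-g) y ∂μ) (hpos k))
  filter_upwards [hup, hlo] with x h1 h2
  rw [Metric.tendsto_atTop']
  intro ε hε
  obtain ⟨k, hk⟩ := exists_nat_one_div_lt hε
  obtain ⟨N, hN⟩ := eventually_atTop.1 ((h1 k).and (h2 k))
  refine ⟨N, fun n hn => ?_⟩
  obtain ⟨h3, h4⟩ := hN n hn.le
  have h5 : birkhoffSum T (-g) n x = -birkhoffSum T g n x := by simp [birkhoffSum]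
  have h6 : ∫ y, (-g) y ∂μ = -∫ y, g y ∂μ := integral_neg _
  rw [h5, h6] at h4
  rw [Real.dist_eq, abs_lt]
  constructor <;> linarith

end PointwiseErgodic

/-! ### Stationary ergodic sequences and the shift -/

section StationarySequences

/-- The shift of real sequences. -/
def seqShift (y : ℕ → ℝ) : ℕ → ℝ := fun n => y (n + 1)

theorem measurable_seqShift : Measurable seqShift :=
  measurable_pi_lambda _ fun n => measurable_pi_apply (n + 1)

theorem seqShift_iterate (k : ℕ) (y : ℕ → ℝ) : seqShift^[k] y = fun n => y (k + n) := by
  induction k generalizing y with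
  | zero => simp
  | succ k ih =>
    rw [Function.iterate_succ_apply, ih]
    ext n
    simp only [seqShift]
    congr 1
    ring

theorem measurableSet_orthant (n : ℕ) (x : ℕ → ℝ) :
    MeasurableSet {y : ℕ → ℝ | ∀ i < n, y i ≤ x i} := by
  have : {y : ℕ → ℝ | ∀ i < n, y i ≤ x i} = ⋂ i, ⋂ (_ : i < n), {y | y i ≤ x i} := by
    ext; simp
  rw [this]
  exact .iInter fun i => .iInter fun _ =>
    measurableSet_le (measurable_pi_apply i) measurable_const

/-- Finite measures on the space of real sequences which agree on all orthants are equal. -/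
theorem Measure.ext_of_orthants {μ ν : Measure (ℕ → ℝ)} [IsFiniteMeasure μ]
    (h : ∀ (n : ℕ) (x : ℕ → ℝ), μ {y | ∀ i < n, y i ≤ x i} = ν {y | ∀ i < n, y i ≤ x i}) :
    μ = ν := by
  refine ext_of_generate_finite {S | ∃ (n : ℕ) (x : ℕ → ℝ), S = {y | ∀ i < n, y i ≤ x i}}
    (le_antisymm ?_ ?_) ?_ ?_ ?_
  · refine iSup_le fun k => ?_
    rw [← measurable_iff_comap_le]
    refine measurable_of_Iic fun a => ?_
    -- An orthant constrains all earlier coordinates too; letting their bound `N` grow removes that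
    -- constraint.
    have : (fun y : ℕ → ℝ => y k) ⁻¹' Set.Iic a =
        ⋃ N : ℕ, {y | ∀ i < k + 1, y i ≤ if i = k then a else N} := by
      ext y
      simp only [Set.mem_preimage, Set.mem_Iic, Set.mem_iUnion, Set.mem_ofPred_eq]
      constructor
      · intro hy
        obtain ⟨C, hC⟩ := ((Finset.range (k + 1)).image y).bddAbove
        obtain ⟨N, hN⟩ := exists_nat_ge C
        refine ⟨N, fun i hi => ?_⟩
        split_ifs with hik
        · rwa [hik]
        · exact (hC (by simpa using ⟨i, Nat.lt_succ_iff.1 hi, rfl⟩)).trans hN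
      · rintro ⟨N, hN⟩
        simpa using hN k k.lt_succ_self
    rw [this]
    exact .iUnion fun N => MeasurableSpace.measurableSet_generateFrom ⟨_, _, rfl⟩
  · refine MeasurableSpace.generateFrom_le ?_
    rintro _ ⟨n, x, rfl⟩
    exact measurableSet_orthant n x
  · rintro _ ⟨n, x, rfl⟩ _ ⟨m, z, rfl⟩ -
    refine ⟨max n m, fun i => if i < n then if i < m then min (x i) (z i) else x i else z i, ?_⟩
    ext y
    simp only [Set.mem_inter_iff, Set.mem_ofPred_eq]
    grind
  · rintro _ ⟨n, x, rfl⟩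
    exact h n x
  · simpa using h 0 0

variable {Ω : Type*} [MeasurableSpace Ω] {P : Measure Ω} [IsProbabilityMeasure P]
  {Xs : ℕ → Ω → ℝ}

theorem IsStationaryErgodic.ergodic_seqShift (h : IsStationaryErgodic P Xs) :
    Ergodic seqShift (P.map fun ω n => Xs n ω) := by
  have hm : Measurable fun ω n => Xs n ω := measurable_pi_lambda _ h.measurable
  have := Measure.isProbabilityMeasure_map (μ := P) hm.aemeasurable
  refine { measurable := measurable_seqShift, map_eq := ?_, aeconst_set := ?_ }
  · symm
    refine Measure.ext_of_orthants fun n x => ?_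
    have hmeas := measurableSet_orthant n x
    rw [Measure.map_map measurable_seqShift hm, Measure.map_apply hm hmeas,
      Measure.map_apply (measurable_seqShift.comp hm) hmeas]
    have := h.stationary 1 n fun i => x i
    convert this using 2
    · ext ω
      simp [Fin.forall_iff]
    · ext ω
      simp [Fin.forall_iff, seqShift, add_comm]
  · intro B hB hBT
    have hiter : ∀ k, seqShift^[k] ⁻¹' B = B := by
      intro k
      induction k with
      | zero => rfl
      | succ k ih => rw [Function.iterate_succ, Set.preimage_comp, ih, hBT]
    -- A shift-invariant `B` equals its preimage under every iterate, so the same `B` serves for all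
    -- `k`.
    have hinv : IsInvariantEvent Xs ((fun ω n => Xs n ω) ⁻¹' B) := by
      refine ⟨hm hB, B, hB, fun k => ?_⟩
      ext ω
      conv_lhs => rw [← hiter k]
      simp only [Set.mem_preimage, seqShift_iterate, Set.mem_ofPred_eq]
    rw [eventuallyConst_set']
    rcases h.ergodic _ hinv with h0 | h1
    · left
      rw [ae_eq_empty, Measure.map_apply hm hB, h0]
    · right
      rw [eventuallyEq_univ, mem_ae_iff_prob_eq_one hB, Measure.map_apply hm hB, h1]

/-- The strong law of large numbers for stationary ergodic sequences. -/
theorem IsStationaryErgodic.ae_tendsto_average (h : IsStationaryErgodic P Xs) {f : ℝ → ℝ}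
    (hf : Measurable f) (hint : Integrable (fun ω => f (Xs 0 ω)) P) :
    ∀ᵐ ω ∂P, Tendsto (fun n : ℕ => (n : ℝ)⁻¹ * ∑ i ∈ Finset.range n, f (Xs i ω)) atTop
      (𝓝 (∫ ω, f (Xs 0 ω) ∂P)) := by
  have hm : Measurable fun ω n => Xs n ω := measurable_pi_lambda _ h.measurable
  have := Measure.isProbabilityMeasure_map (μ := P) hm.aemeasurable
  have hgm : Measurable fun y : ℕ → ℝ => f (y 0) := hf.comp (measurable_pi_apply 0)
  have hB := h.ergodic_seqShift.ae_tendsto_birkhoffSum hgm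
    ((integrable_map_measure hgm.aestronglyMeasurable hm.aemeasurable).2 hint)
  rw [integral_map hm.aemeasurable hgm.aestronglyMeasurable] at hB
  filter_upwards [ae_of_ae_map hm.aemeasurable hB] with ω hω
  simpa [birkhoffSum, seqShift_iterate] using hω

end StationarySequences

/-! ### Successive halving of the sample space -/

section CellIndex

variable {Ω : Type*} {half : Set Ω → Set Ω}

open Classical in
/-- The index of the cell containing `ω`, in the `n`-th partition of `Ω` got from the trivial one
by splitting each cell `A` into `half A` and its complement. -/
noncomputable def cellIndex (half : Set Ω → Set Ω) : ℕ → Ω → ℕ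
  | 0, _ => 0
  | n + 1, ω => 2 * cellIndex half n ω +
      if ω ∈ half (cellIndex half n ⁻¹' {cellIndex half n ω}) then 0 else 1

/-- Cell `k` has children `2k` (the chosen half) and `2k + 1` (the rest), so the indices record
binary digits. -/
theorem cellIndex_preimage_even {n k : ℕ}
    (hsub : half (cellIndex half n ⁻¹' {k}) ⊆ cellIndex half n ⁻¹' {k}) :
    cellIndex half (n + 1) ⁻¹' {2 * k} = half (cellIndex half n ⁻¹' {k}) := by
  ext ω
  simp only [Set.mem_preimage, Set.mem_singleton_iff, cellIndex]
  constructor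
  · intro h
    split_ifs at h with h1
    · rwa [show cellIndex half n ω = k by omega] at h1
    · omega
  · intro h
    have hk : cellIndex half n ω = k := hsub h
    rw [hk, if_pos h, add_zero]

theorem cellIndex_preimage_odd (n k : ℕ) :
    cellIndex half (n + 1) ⁻¹' {2 * k + 1} =
      cellIndex half n ⁻¹' {k} \ half (cellIndex half n ⁻¹' {k}) := by
  ext ω
  simp only [Set.mem_preimage, Set.mem_singleton_iff, cellIndex, Set.mem_sdiff]
  constructor
  · intro h
    split_ifs at h with h1
    · omega
    · have hk : cellIndex half n ω = k := by omega
      rw [hk] at h1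
      exact ⟨hk, h1⟩
  · rintro ⟨hk, h⟩
    rw [hk, if_neg h]

end CellIndex

/-! ### Sierpiński's theorem and a uniform random variable -/

section Nonatomic

variable {Ω : Type*} [MeasurableSpace Ω] {P : Measure Ω} [IsProbabilityMeasure P]

/-- Of a proper piece and its complement, one has at most half the measure. -/
theorem IsNonatomic.exists_subset_le_pow (hP : IsNonatomic P) {A : Set Ω} (hA : MeasurableSet A)
    (hpos : 0 < P.real A) (n : ℕ) :
    ∃ B, MeasurableSet B ∧ B ⊆ A ∧ 0 < P.real B ∧ P.real B ≤ P.real A * (1 / 2) ^ n := by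
  induction n with
  | zero => exact ⟨A, hA, subset_rfl, hpos, by simp⟩
  | succ n ih =>
    obtain ⟨B, hB, hBA, hB0, hBn⟩ := ih
    obtain ⟨C, hC, hCB, hC0, hClt⟩ := hP B hB (by
      rw [measureReal_def, ENNReal.toReal_pos_iff] at hB0
      exact hB0.1)
    have hC0' : 0 < P.real C := ENNReal.toReal_pos hC0.ne' (measure_ne_top _ _)
    have hClt' : P.real C < P.real B := by
      rwa [measureReal_def, measureReal_def,
        ENNReal.toReal_lt_toReal (measure_ne_top _ _) (measure_ne_top _ _)]
    have hsum : P.real (B \ C) = P.real B - P.real C := measureReal_sdiff hCB hC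
    rw [pow_succ]
    by_cases h : P.real C ≤ P.real B / 2
    · exact ⟨C, hC, hCB.trans hBA, hC0', by linarith⟩
    · exact ⟨B \ C, hB.diff hC, Set.sdiff_subset.trans hBA, by linarith, by linarith⟩

/-- Sierpiński's theorem: nonatomic probability measures take all intermediate values. -/
theorem IsNonatomic.exists_subset_measureReal_eq (hP : IsNonatomic P) {A : Set Ω}
    (hA : MeasurableSet A) {c : ℝ} (hc0 : 0 ≤ c) (hc : c ≤ P.real A) :
    ∃ B, MeasurableSet B ∧ B ⊆ A ∧ P.real B = c := by
  let S := {C : Set Ω // MeasurableSet C ∧ C ⊆ A ∧ P.real C ≤ c}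
  -- Greedy exhaustion: `D` achieves at least half of the gain in measure that any admissible
  -- extension of `C` allows.
  have hstep : ∀ C : S, ∃ D : S, C.1 ⊆ D.1 ∧
      ∀ E : S, C.1 ⊆ E.1 → (P.real C.1 + P.real E.1) / 2 ≤ P.real D.1 := by
    intro C
    let V : Set ℝ := {r | ∃ E : S, C.1 ⊆ E.1 ∧ P.real E.1 = r}
    have hV : BddAbove V := ⟨c, by rintro _ ⟨E, -, rfl⟩; exact E.2.2.2⟩
    by_cases h : sSup V ≤ P.real C.1
    · refine ⟨C, subset_rfl, fun E hE => ?_⟩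
      have : P.real E.1 ≤ sSup V := le_csSup hV ⟨E, hE, rfl⟩
      linarith
    · obtain ⟨_, ⟨D, hCD, rfl⟩, hD⟩ := exists_lt_of_lt_csSup
        (⟨_, C, subset_rfl, rfl⟩ : V.Nonempty)
        (show (P.real C.1 + sSup V) / 2 < sSup V by linarith [not_le.1 h])
      refine ⟨D, hCD, fun E hE => ?_⟩
      have : P.real E.1 ≤ sSup V := le_csSup hV ⟨E, hE, rfl⟩
      linarith
  choose next hnext_sub hnext using hstep
  let C : ℕ → S := fun n => next^[n] ⟨∅, .empty, Set.empty_subset _, by simpa using hc0⟩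
  have hC : ∀ n, C (n + 1) = next (C n) := fun n => Function.iterate_succ_apply' _ _ _
  have hmono : Monotone fun n => (C n).1 := monotone_nat_of_le_succ fun n => by
    simp only [hC]
    exact hnext_sub _
  set B := ⋃ n, (C n).1 with hB
  have hBm : MeasurableSet B := .iUnion fun n => (C n).2.1
  have hBA : B ⊆ A := Set.iUnion_subset fun n => (C n).2.2.1
  have hlim : Tendsto (fun n => P.real (C n).1) atTop (𝓝 (P.real B)) :=
    (ENNReal.tendsto_toReal (measure_ne_top _ _)).comp (tendsto_measure_iUnion_atTop hmono)
  have hle : P.real B ≤ c := le_of_tendsto' hlim fun n => (C n).2.2.2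
  refine ⟨B, hBm, hBA, hle.antisymm (not_lt.1 fun hlt => ?_)⟩
  have hdiff : P.real (A \ B) = P.real A - P.real B := measureReal_sdiff hBA hBm
  -- If `B` falls short of `c`, a small enough `D` outside `B` leaves `B ∪ D` admissible. It extends
  -- every `C n`, so the greedy inequality in the limit forces `P.real D ≤ 0`.
  obtain ⟨n, hn⟩ := exists_pow_lt_of_lt_one (sub_pos.2 hlt) (one_half_lt_one (α := ℝ))
  obtain ⟨D, hD, hDA, hD0, hDn⟩ :=
    hP.exists_subset_le_pow (hA.diff hBm) (by rw [hdiff]; linarith) n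
  have hDc : P.real D ≤ c - P.real B := by
    have h1 : P.real (A \ B) ≤ 1 := measureReal_le_one
    have h2 : (0 : ℝ) < (1 / 2) ^ n := by positivity
    nlinarith
  have hBD : P.real (B ∪ D) = P.real B + P.real D :=
    measureReal_union (Set.disjoint_left.2 fun x hx hx' => (hDA hx').2 hx) hD
  let E : S := ⟨B ∪ D, hBm.union hD, Set.union_subset hBA (hDA.trans Set.sdiff_subset), by linarith⟩
  have hE : ∀ n, (P.real (C n).1 + P.real (B ∪ D)) / 2 ≤ P.real (C (n + 1)).1 := fun n => by
    rw [hC]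
    exact hnext _ E ((Set.subset_iUnion (fun n => (C n).1) n).trans Set.subset_union_left)
  have := le_of_tendsto_of_tendsto' ((hlim.add_const _).div_const 2)
    ((tendsto_add_atTop_iff_nat 1).2 hlim) hE
  linarith

theorem IsNonatomic.exists_half (hP : IsNonatomic P) :
    ∃ half : Set Ω → Set Ω, ∀ A, MeasurableSet A →
      MeasurableSet (half A) ∧ half A ⊆ A ∧ P.real (half A) = P.real A / 2 := by
  have : ∀ A : Set Ω, ∃ B, MeasurableSet A →
      MeasurableSet B ∧ B ⊆ A ∧ P.real B = P.real A / 2 := fun A => by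
    by_cases hA : MeasurableSet A
    · have h0 : 0 ≤ P.real A := measureReal_nonneg
      obtain ⟨B, hB⟩ := hP.exists_subset_measureReal_eq hA (c := P.real A / 2)
        (by linarith) (by linarith)
      exact ⟨B, fun _ => hB⟩
    · exact ⟨∅, fun h => absurd h hA⟩
  choose half h using this
  exact ⟨half, h⟩

theorem cellIndex_preimage {half : Set Ω → Set Ω} (hhalf : ∀ A, MeasurableSet A →
      MeasurableSet (half A) ∧ half A ⊆ A ∧ P.real (half A) = P.real A / 2) (n k : ℕ) :
    MeasurableSet (cellIndex half n ⁻¹' {k}) ∧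
      P.real (cellIndex half n ⁻¹' {k}) = if k < 2 ^ n then (1 / 2) ^ n else 0 := by
  induction n generalizing k with
  | zero =>
    rcases k with _ | k
    · have : cellIndex half 0 ⁻¹' {0} = Set.univ := by ext; simp [cellIndex]
      simp [this]
    · have : cellIndex half 0 ⁻¹' {k + 1} = ∅ := by ext; simp [cellIndex]
      simp [this]
  | succ n ih =>
    rcases Nat.even_or_odd' k with ⟨k, rfl | rfl⟩
    · obtain ⟨h1, h2, h3⟩ := hhalf _ (ih k).1
      rw [cellIndex_preimage_even h2]
      refine ⟨h1, ?_⟩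
      rw [h3, (ih k).2, pow_succ, pow_succ]
      split_ifs <;> first | omega | ring
    · obtain ⟨h1, h2, h3⟩ := hhalf _ (ih k).1
      rw [cellIndex_preimage_odd]
      refine ⟨(ih k).1.diff h1, ?_⟩
      rw [measureReal_sdiff h2 h1, h3, (ih k).2, pow_succ, pow_succ]
      split_ifs <;> first | omega | ring

/-- On a nonatomic probability space there is a random variable with the uniform distribution. -/
theorem IsNonatomic.exists_uniform (hP : IsNonatomic P) :
    ∃ U : Ω → ℝ, Measurable U ∧ P.map U = volume.restrict (Set.Ioo 0 1) := by
  obtain ⟨half, hhalf⟩ := hP.exists_half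
  have hcell := cellIndex_preimage hhalf
  set u := cellIndex half with hu
  have hum : ∀ n, Measurable (u n) := fun n => measurable_to_countable' fun k => (hcell n k).1
  have hstep : ∀ n ω, u (n + 1) ω = 2 * u n ω ∨ u (n + 1) ω = 2 * u n ω + 1 := by
    intro n ω
    simp only [hu, cellIndex]
    split_ifs <;> simp
  -- The intervals `[u n / 2 ^ n, (u n + 1) / 2 ^ n]` are nested, and `U` is their common point.
  have hmono : ∀ ω, Monotone fun n => (u n ω : ℝ) / 2 ^ n := by
    refine fun ω => monotone_nat_of_le_succ fun n => ?_
    rw [div_le_div_iff₀ (by positivity) (by positivity), pow_succ]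
    have : (2 * u n ω : ℝ) ≤ u (n + 1) ω := by
      exact_mod_cast (by rcases hstep n ω with h | h <;> omega)
    have h2 : (0 : ℝ) < 2 ^ n := by positivity
    nlinarith
  have hanti : ∀ ω, Antitone fun n => ((u n ω : ℝ) + 1) / 2 ^ n := by
    refine fun ω => antitone_nat_of_succ_le fun n => ?_
    rw [div_le_div_iff₀ (by positivity) (by positivity), pow_succ]
    have : (u (n + 1) ω : ℝ) ≤ 2 * u n ω + 1 := by
      exact_mod_cast (by rcases hstep n ω with h | h <;> omega)
    have h2 : (0 : ℝ) < 2 ^ n := by positivity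
    nlinarith
  have hbound : ∀ ω m n, (u m ω : ℝ) / 2 ^ m ≤ ((u n ω : ℝ) + 1) / 2 ^ n := fun ω m n =>
    calc (u m ω : ℝ) / 2 ^ m ≤ (u (max m n) ω : ℝ) / 2 ^ (max m n) := hmono ω (le_max_left _ _)
      _ ≤ ((u (max m n) ω : ℝ) + 1) / 2 ^ (max m n) := by gcongr; linarith
      _ ≤ _ := hanti ω (le_max_right _ _)
  let U : Ω → ℝ := fun ω => ⨆ n, (u n ω : ℝ) / 2 ^ n
  have hbdd : ∀ ω, BddAbove (Set.range fun n => (u n ω : ℝ) / 2 ^ n) := fun ω =>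
    ⟨_, by rintro _ ⟨m, rfl⟩; exact hbound ω m 0⟩
  have hUlo : ∀ n ω, (u n ω : ℝ) / 2 ^ n ≤ U ω := fun n ω => le_ciSup (hbdd ω) n
  have hUhi : ∀ n ω, U ω ≤ ((u n ω : ℝ) + 1) / 2 ^ n := fun n ω => ciSup_le fun m => hbound ω m n
  have hU : Measurable U := Measurable.iSup fun n =>
    (measurable_from_top.comp (hum n)).div_const _
  have hcount : ∀ n k, P.real {ω | u n ω < k} ≤ k / 2 ^ n ∧
      (k ≤ 2 ^ n → P.real {ω | u n ω < k} = k / 2 ^ n) := by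
    intro n k
    induction k with
    | zero => simp
    | succ k ih =>
      have h1 : {ω | u n ω < k + 1} = {ω | u n ω < k} ∪ u n ⁻¹' {k} := by
        ext ω
        simp only [Set.mem_ofPred_eq, Set.mem_union, Set.mem_preimage, Set.mem_singleton_iff]
        omega
      have h2 : P.real {ω | u n ω < k + 1} = P.real {ω | u n ω < k} + P.real (u n ⁻¹' {k}) := by
        rw [h1, measureReal_union _ (hcell n k).1]
        exact Set.disjoint_left.2 fun ω (hω : u n ω < k) (h : u n ω = k) => hω.ne h
      rw [h2, (hcell n k).2]
      push_cast
      rw [add_div, one_div_pow]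
      constructor
      · have : (0 : ℝ) < 1 / 2 ^ n := by positivity
        split_ifs <;> linarith [ih.1]
      · intro hk
        rw [if_pos (by omega), ih.2 (by omega)]
  have hcdf : ∀ t : ℝ, 0 ≤ t → t ≤ 1 → P.real {ω | U ω ≤ t} = t := by
    intro t ht0 ht1
    have hpow : Tendsto (fun n : ℕ => (1 / 2 : ℝ) ^ n) atTop (𝓝 0) :=
      tendsto_pow_atTop_nhds_zero_of_lt_one (by norm_num) (by norm_num)
    -- With `k = ⌊t * 2 ^ n⌋₊`, the event `U ≤ t` lies between `u n < k` and `u n < k + 1`.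
    have key : ∀ n : ℕ, t - (1 / 2) ^ n ≤ P.real {ω | U ω ≤ t} ∧
        P.real {ω | U ω ≤ t} ≤ t + (1 / 2) ^ n := by
      intro n
      have h2 : (0 : ℝ) < 2 ^ n := by positivity
      set k := ⌊t * 2 ^ n⌋₊ with hk
      have hk1 : (k : ℝ) ≤ t * 2 ^ n := Nat.floor_le (by positivity)
      have hk2 : t * 2 ^ n < k + 1 := Nat.lt_floor_add_one _
      have hk3 : k ≤ 2 ^ n := by
        have : (k : ℝ) ≤ 2 ^ n := by nlinarith
        exact_mod_cast this
      have e : (1 / 2 : ℝ) ^ n = 1 / 2 ^ n := by rw [one_div_pow]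
      constructor
      · have hsub : {ω | u n ω < k} ⊆ {ω | U ω ≤ t} := fun ω (hω : u n ω < k) => by
          refine (hUhi n ω).trans ?_
          rw [div_le_iff₀ h2]
          have : (u n ω : ℝ) + 1 ≤ k := by exact_mod_cast hω
          linarith
        have := measureReal_mono (μ := P) hsub
        rw [(hcount n k).2 hk3] at this
        refine le_trans ?_ this
        rw [e, sub_le_iff_le_add, ← add_div, le_div_iff₀ h2]
        exact hk2.le
      · have hsub : {ω | U ω ≤ t} ⊆ {ω | u n ω < k + 1} := fun ω (hω : U ω ≤ t) => by
          refine Nat.lt_succ_iff.2 (Nat.le_floor ?_)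
          rw [← div_le_iff₀ h2]
          exact (hUlo n ω).trans hω
        refine (measureReal_mono (μ := P) hsub).trans ((hcount n (k + 1)).1.trans ?_)
        rw [e, ← sub_le_iff_le_add, ← sub_div, div_le_iff₀ h2]
        push_cast
        linarith
    have hhi := hpow.const_add t
    have hlo := hpow.const_sub t
    rw [add_zero] at hhi
    rw [sub_zero] at hlo
    exact le_antisymm (ge_of_tendsto' hhi fun n => (key n).2)
      (le_of_tendsto' hlo fun n => (key n).1)
  refine ⟨U, hU, ?_⟩
  have := Measure.isProbabilityMeasure_map (μ := P) hU.aemeasurable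
  refine Measure.ext_of_Iic _ _ fun t => ?_
  rw [Measure.map_apply hU measurableSet_Iic, Measure.restrict_apply measurableSet_Iic]
  change P {ω | U ω ≤ t} = _
  rw [← ofReal_measureReal]
  rcases lt_or_ge t 0 with ht | ht
  · have h1 : P.real {ω | U ω ≤ t} = 0 :=
      le_antisymm ((measureReal_mono fun ω (hω : U ω ≤ t) => hω.trans ht.le).trans
        (hcdf 0 le_rfl zero_le_one).le) measureReal_nonneg
    have h2 : Set.Iic t ∩ Set.Ioo 0 1 = ∅ := by
      ext x
      simp only [Set.mem_inter_iff, Set.mem_Iic, Set.mem_Ioo, Set.mem_empty_iff_false]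
      grind
    rw [h1, h2]
    simp
  rcases le_or_gt t 1 with ht1 | ht1
  · rw [hcdf t ht ht1]
    refine le_antisymm ?_ ?_
    · have : Set.Ioo 0 t ⊆ Set.Iic t ∩ Set.Ioo 0 1 := fun x hx => ⟨hx.2.le, hx.1, hx.2.trans_le ht1⟩
      simpa using measure_mono (μ := volume) this
    · have : Set.Iic t ∩ Set.Ioo 0 1 ⊆ Set.Icc 0 t := fun x hx => ⟨hx.2.1.le, hx.1⟩
      simpa using measure_mono (μ := volume) this
  · have h1 : P.real {ω | U ω ≤ t} = 1 :=
      le_antisymm measureReal_le_one ((hcdf 1 zero_le_one le_rfl).ge.trans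
        (measureReal_mono fun ω (hω : U ω ≤ 1) => hω.trans ht1.le))
    have h2 : Set.Iic t ∩ Set.Ioo 0 1 = Set.Ioo 0 1 :=
      Set.inter_eq_right.2 fun x hx => hx.2.le.trans ht1.le
    rw [h1, h2]
    simp

end Nonatomic

/-! ### Quantile functions -/

section Quantile

/-- The lower quantile function of a distribution on the line. -/
noncomputable def quantile (μ : Measure ℝ) (u : ℝ) : ℝ := sInf {x | u ≤ cdf μ x}

/-- For `u` in the open interval the defining set is nonempty and bounded below, so `sInf` is a
genuine infimum; right continuity of the distribution function makes it attained. -/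
theorem quantile_le_iff (μ : Measure ℝ) {u : ℝ} (hu : u ∈ Set.Ioo (0 : ℝ) 1) (x : ℝ) :
    quantile μ u ≤ x ↔ u ≤ cdf μ x := by
  have hne : {x | u ≤ cdf μ x}.Nonempty :=
    ((tendsto_cdf_atTop μ).eventually_const_le hu.2).exists
  obtain ⟨b, hb⟩ := ((tendsto_cdf_atBot μ).eventually_lt_const hu.1).exists
  have hbdd : BddBelow {x | u ≤ cdf μ x} := ⟨b, fun y (hy : u ≤ cdf μ y) => by
    by_contra! h
    linarith [monotone_cdf μ h.le]⟩
  constructor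
  · intro h
    have hright : Tendsto (cdf μ) (𝓝[>] x) (𝓝 (cdf μ x)) :=
      ((cdf μ).right_continuous x).mono_left (nhdsWithin_mono _ Set.Ioi_subset_Ici_self)
    refine ge_of_tendsto hright ?_
    filter_upwards [self_mem_nhdsWithin] with y hy
    obtain ⟨z, hz, hzy⟩ := exists_lt_of_csInf_lt hne (h.trans_lt hy)
    exact (show u ≤ cdf μ z from hz).trans (monotone_cdf μ hzy.le)
  · exact fun h => csInf_le hbdd h

theorem aemeasurable_quantile (μ : Measure ℝ) :
    AEMeasurable (quantile μ) (volume.restrict (Set.Ioo 0 1)) :=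
  aemeasurable_restrict_of_monotoneOn measurableSet_Ioo fun _ hu _ hv huv =>
    (quantile_le_iff μ hu _).2 (huv.trans ((quantile_le_iff μ hv _).1 le_rfl))

/-- The quantile function, as a random variable on the unit interval, has the given law. -/
theorem map_quantile (μ : Measure ℝ) [IsProbabilityMeasure μ] :
    (volume.restrict (Set.Ioo 0 1)).map (quantile μ) = μ := by
  refine Measure.ext_of_Iic _ _ fun x => ?_
  rw [Measure.map_apply_of_aemeasurable (aemeasurable_quantile μ) measurableSet_Iic,
    Measure.restrict_apply₀' measurableSet_Ioo.nullMeasurableSet, ← ofReal_cdf]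
  have hset : quantile μ ⁻¹' Set.Iic x ∩ Set.Ioo 0 1 = Set.Iic (cdf μ x) ∩ Set.Ioo 0 1 := by
    ext u
    simp only [Set.mem_inter_iff, Set.mem_preimage, Set.mem_Iic]
    exact and_congr_left fun hu => quantile_le_iff μ hu x
  rw [hset]
  refine le_antisymm ?_ ?_
  · have : Set.Iic (cdf μ x) ∩ Set.Ioo 0 1 ⊆ Set.Icc 0 (cdf μ x) := fun u hu => ⟨hu.2.1.le, hu.1⟩
    simpa using measure_mono (μ := volume) this
  · have : Set.Ioo 0 (cdf μ x) ⊆ Set.Iic (cdf μ x) ∩ Set.Ioo 0 1 :=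
      fun u hu => ⟨hu.2.le, hu.1, hu.2.trans_le (cdf_le_one μ x)⟩
    simpa using measure_mono (μ := volume) this

/-- If the distribution functions converge at the rationals, then the quantile functions converge
almost everywhere. -/
theorem ae_tendsto_quantile {μs : ℕ → Measure ℝ} {μ : Measure ℝ}
    (h : ∀ q : ℚ, Tendsto (fun n => cdf (μs n) q) atTop (𝓝 (cdf μ q))) :
    ∀ᵐ u ∂(volume.restrict (Set.Ioo (0 : ℝ) 1)),
      Tendsto (fun n => quantile (μs n) u) atTop (𝓝 (quantile μ u)) := by
  -- Off these countably many levels, `u ≤ cdf μ q` is strict and so survives the passage to large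
  -- `n`. Only the upper bound needs this.
  have hnull : ∀ᵐ u ∂(volume.restrict (Set.Ioo (0 : ℝ) 1)),
      u ∉ Set.range fun q : ℚ => cdf μ (q : ℝ) :=
    ((Set.countable_range fun q : ℚ => cdf μ (q : ℝ)).ae_notMem _)
  filter_upwards [hnull, ae_restrict_mem measurableSet_Ioo] with u hu hu01
  refine tendsto_order.2 ⟨fun a ha => ?_, fun a ha => ?_⟩
  · obtain ⟨q, haq, hq⟩ := exists_rat_btwn ha
    have hlt : cdf μ q < u := by
      rw [← not_le, ← quantile_le_iff μ hu01]
      exact not_le.2 hq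
    filter_upwards [(h q).eventually_lt_const hlt] with n hn
    refine haq.trans ?_
    rw [← not_le, quantile_le_iff _ hu01]
    exact not_le.2 hn
  · obtain ⟨q, hq, hqa⟩ := exists_rat_btwn ha
    have hlt : u < cdf μ q :=
      lt_of_le_of_ne ((quantile_le_iff μ hu01 _).1 hq.le) fun heq => hu ⟨q, heq.symm⟩
    filter_upwards [(h q).eventually_const_lt hlt] with n hn
    exact ((quantile_le_iff _ hu01 _).2 hn.le).trans_lt hqa

end Quantile

/-! ### Scheffé's lemma and dominated subsequences -/

section Dominated

variable {Ω : Type*} [MeasurableSpace Ω] {P : Measure Ω}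

/-- A sequence of nonnegative functions which converges almost everywhere, and whose integrals
converge to the integral of the limit, converges in mean (Scheffé's lemma). -/
theorem tendsto_integral_abs_sub_of_tendsto_integral {f : ℕ → Ω → ℝ} {g : Ω → ℝ}
    (hf : ∀ n, Integrable (f n) P) (hg : Integrable g P) (hf0 : ∀ n, 0 ≤ᵐ[P] f n)
    (hlim : ∀ᵐ ω ∂P, Tendsto (fun n => f n ω) atTop (𝓝 (g ω)))
    (hint : Tendsto (fun n => ∫ ω, f n ω ∂P) atTop (𝓝 (∫ ω, g ω ∂P))) :
    Tendsto (fun n => ∫ ω, |f n ω - g ω| ∂P) atTop (𝓝 0) := by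
  have hg0 : 0 ≤ᵐ[P] g := by
    filter_upwards [hlim, ae_all_iff.2 hf0] with ω h1 h2
    exact ge_of_tendsto' h1 h2
  have hmax : Tendsto (fun n => ∫ ω, max (g ω - f n ω) 0 ∂P) atTop (𝓝 (∫ _, (0 : ℝ) ∂P)) := by
    refine tendsto_integral_of_dominated_convergence g
      (fun n => ((hg.sub (hf n)).sup (integrable_zero Ω ℝ P)).aestronglyMeasurable) hg
      (fun n => ?_) ?_
    · filter_upwards [hf0 n, hg0] with ω h1 h2
      simp only [Pi.zero_apply] at h1 h2
      rw [Real.norm_of_nonneg (le_max_right _ _)]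
      exact max_le (by linarith) h2
    · filter_upwards [hlim] with ω h
      simpa using (h.const_sub (g ω)).max (tendsto_const_nhds (x := (0 : ℝ)))
  -- `|f - g| = 2 (g - f)⁺ + (f - g)`: the positive part is dominated by `g`, and the rest is
  -- controlled by the integrals.
  have heq : ∀ n, ∫ ω, |f n ω - g ω| ∂P =
      2 * ∫ ω, max (g ω - f n ω) 0 ∂P + (∫ ω, f n ω ∂P - ∫ ω, g ω ∂P) := fun n => by
    rw [← integral_const_mul, ← integral_sub (hf n) hg, ← integral_add]
    · congr 1 with ω
      rcases max_cases (g ω - f n ω) 0 with ⟨h1, h2⟩ | ⟨h1, h2⟩ <;> rw [h1] <;>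
        cases abs_cases (f n ω - g ω) <;> linarith
    · exact ((hg.sub (hf n)).sup (integrable_zero Ω ℝ P)).const_mul 2
    · exact (hf n).sub hg
  simp_rw [heq]
  simpa using (hmax.const_mul 2).add (hint.sub_const (∫ ω, g ω ∂P))

/-- A sequence which converges in mean has a subsequence dominated by an integrable function. -/
theorem exists_subseq_dominated {f : ℕ → Ω → ℝ} {g : Ω → ℝ}
    (hf : ∀ n, Integrable (f n) P) (hg : Integrable g P)
    (hlim : Tendsto (fun n => ∫ ω, |f n ω - g ω| ∂P) atTop (𝓝 0)) :
    ∃ φ : ℕ → ℕ, StrictMono φ ∧ ∃ G : Ω → ℝ, Integrable G P ∧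
      ∀ᵐ ω ∂P, ∀ k, f (φ k) ω ≤ G ω := by
  -- Along so fast a subsequence the deviations `|f (φ k) - g|` have an integrable sum; adding it to
  -- `g` gives `G`.
  obtain ⟨φ, hφ, hφlt⟩ := extraction_forall_of_eventually' (P := fun k n =>
    ∫ ω, |f n ω - g ω| ∂P < (1 / 2) ^ k) fun k => by
      obtain ⟨N, hN⟩ := eventually_atTop.1 (hlim.eventually_lt_const
        (show (0 : ℝ) < (1 / 2) ^ k by positivity))
      exact ⟨N, hN⟩
  have hint : ∀ k, Integrable (fun ω => |f (φ k) ω - g ω|) P := fun k => ((hf _).sub hg).abs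
  have hsum : Summable fun k => ∫ ω, ‖|f (φ k) ω - g ω|‖ ∂P := by
    refine Summable.of_nonneg_of_le (fun k => integral_nonneg fun ω => norm_nonneg _)
      (fun k => ?_) (summable_geometric_of_lt_one (r := 1 / 2) (by norm_num) (by norm_num))
    simpa using (hφlt k).le
  have hmeas := fun k => (hint k).aestronglyMeasurable
  have hlint : ∫⁻ ω, ∑' k, ‖|f (φ k) ω - g ω|‖ₑ ∂P ≠ ∞ := by
    rw [lintegral_tsum fun k => (hmeas k).enorm]
    simp_rw [← ofReal_integral_norm_eq_lintegral_enorm (hint _)]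
    exact hsum.tsum_ofReal_ne_top
  have hae : ∀ᵐ ω ∂P, Summable fun k => |f (φ k) ω - g ω| := by
    filter_upwards [ae_lt_top' (AEMeasurable.tsum fun k => (hmeas k).enorm) hlint] with ω hω
    exact Summable.of_enorm hω.ne
  refine ⟨φ, hφ, fun ω => g ω + ∑' k, |f (φ k) ω - g ω|,
    hg.add ?_, ?_⟩
  · refine ⟨(AEMeasurable.tsum fun k => (hmeas k).aemeasurable).aestronglyMeasurable, ?_⟩
    refine lt_of_le_of_lt (lintegral_mono fun ω => ?_) hlint.lt_top
    exact enorm_tsum_le_tsum_enorm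
  · filter_upwards [hae] with ω hω k
    have h1 := hω.le_tsum k fun j _ => abs_nonneg (f (φ j) ω - g ω)
    have h2 := le_abs_self (f (φ k) ω - g ω)
    linarith

end Dominated

/-! ### Modulars and order convergence in the Orlicz space -/

section Orlicz

variable {Φ : ℝ≥0 → ℝ≥0}

theorem IsOrliczFunction.map_mul_le (hΦ : IsOrliczFunction Φ) {t : ℝ≥0} (ht : t ≤ 1) (x : ℝ≥0) :
    Φ (t * x) ≤ t * Φ x := by
  have h := hΦ.convex.2 (Set.mem_univ x) (Set.mem_univ 0) zero_le zero_le
    (add_tsub_cancel_of_le ht)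
  simpa [hΦ.map_zero] using h

/-- Extending by zero to the negative axis makes `0` an interior point, so convexity yields
continuity there as well. -/
theorem IsOrliczFunction.convexOn_toNNReal (hΦ : IsOrliczFunction Φ) :
    ConvexOn ℝ Set.univ fun x : ℝ => (Φ x.toNNReal : ℝ) := by
  refine ⟨convex_univ, fun x _ y _ a b ha hb hab => ?_⟩
  lift a to ℝ≥0 using ha
  lift b to ℝ≥0 using hb
  have h := hΦ.convex.2 (Set.mem_univ x.toNNReal) (Set.mem_univ y.toNNReal) zero_le zero_le
    (by exact_mod_cast hab)
  have hle : ((a : ℝ) • x + (b : ℝ) • y).toNNReal ≤ a • x.toNNReal + b • y.toNNReal := by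
    refine Real.toNNReal_le_iff_le_coe.2 ?_
    push_cast [smul_eq_mul, Real.coe_toNNReal']
    gcongr <;> exact le_max_left _ _
  have h' := (hΦ.mono hle).trans h
  exact_mod_cast h'

theorem IsOrliczFunction.continuous_toNNReal (hΦ : IsOrliczFunction Φ) :
    Continuous fun x : ℝ => (Φ x.toNNReal : ℝ) := by
  rw [← continuousOn_univ]
  exact hΦ.convexOn_toNNReal.continuousOn isOpen_univ

/-- The function `x ↦ Φ (l * x⁺)` on the line. -/
noncomputable def scaledOrlicz (Φ : ℝ≥0 → ℝ≥0) (l : ℝ≥0) (x : ℝ) : ℝ := Φ (l * x).toNNReal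

theorem IsOrliczFunction.continuous_scaledOrlicz (hΦ : IsOrliczFunction Φ) (l : ℝ≥0) :
    Continuous (scaledOrlicz Φ l) :=
  hΦ.continuous_toNNReal.comp (continuous_const.mul continuous_id)

theorem IsOrliczFunction.monotone_scaledOrlicz (hΦ : IsOrliczFunction Φ) (l : ℝ≥0) :
    Monotone (scaledOrlicz Φ l) := fun x y hxy => by
  simp only [scaledOrlicz, NNReal.coe_le_coe]
  exact hΦ.mono (Real.toNNReal_mono (by gcongr))

theorem scaledOrlicz_nonneg (Φ : ℝ≥0 → ℝ≥0) (l : ℝ≥0) (x : ℝ) : 0 ≤ scaledOrlicz Φ l x :=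
  NNReal.coe_nonneg _

theorem ofReal_scaledOrlicz_abs (Φ : ℝ≥0 → ℝ≥0) (l : ℝ≥0) (x : ℝ) :
    ENNReal.ofReal (scaledOrlicz Φ l |x|) = Φ (l * ‖x‖₊) := by
  have : (l * |x|).toNNReal = l * ‖x‖₊ := by
    ext
    simp [abs_nonneg, mul_nonneg]
  rw [scaledOrlicz, this, ENNReal.ofReal_coe_nnreal]

variable {Ω : Type*} [MeasurableSpace Ω] {P : Measure Ω}

theorem IsOrliczFunction.integrable_iff_lintegral_lt_top (hΦ : IsOrliczFunction Φ) (l : ℝ≥0)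
    (X : Ω →ₘ[P] ℝ) :
    Integrable (fun ω => scaledOrlicz Φ l |X ω|) P ↔ ∫⁻ ω, (Φ (l * ‖X ω‖₊) : ℝ≥0∞) ∂P < ∞ := by
  have hm : AEStronglyMeasurable (fun ω => scaledOrlicz Φ l |X ω|) P :=
    ((hΦ.continuous_scaledOrlicz l).comp continuous_abs).comp_aestronglyMeasurable
      X.aestronglyMeasurable
  rw [Integrable, and_iff_right hm,
    hasFiniteIntegral_iff_ofReal (ae_of_all _ fun ω => scaledOrlicz_nonneg Φ l _)]
  simp_rw [ofReal_scaledOrlicz_abs]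

/-- The elements of the Orlicz space are the random variables with a finite modular at some
scale. -/
theorem IsOrliczFunction.mem_orliczSpace_iff (hΦ : IsOrliczFunction Φ) {X : Ω →ₘ[P] ℝ} :
    X ∈ OrliczSpace P Φ ↔
      ∃ l : ℝ≥0, 0 < l ∧ Integrable (fun ω => scaledOrlicz Φ l |X ω|) P := by
  simp_rw [hΦ.integrable_iff_lintegral_lt_top]
  constructor
  · intro h
    obtain ⟨l, h⟩ := iInf_lt_iff.1 (show luxemburgNorm P Φ X < ∞ from h)
    obtain ⟨⟨hl, hle⟩, -⟩ := iInf_lt_iff.1 h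
    exact ⟨l, hl, hle.trans_lt ENNReal.one_lt_top⟩
  · rintro ⟨l, hl, hlt⟩
    obtain ⟨c, hc⟩ : ∃ c : ℝ≥0, (c : ℝ≥0∞) = ∫⁻ ω, (Φ (l * ‖X ω‖₊) : ℝ≥0∞) ∂P :=
      ⟨_, ENNReal.coe_toNNReal hlt.ne⟩
    -- Since `Φ(t x) ≤ t Φ(x)` for `t ≤ 1`, shrinking the scale by `t` brings the modular `c` down
    -- to at most `t c ≤ 1`.
    set t : ℝ≥0 := (1 + c)⁻¹ with ht
    have ht0 : 0 < t := by positivity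
    have ht1 : t ≤ 1 := inv_le_one_of_one_le₀ (by simp)
    have htc : t * c ≤ 1 := by
      rw [ht, inv_mul_le_iff₀ (by positivity), mul_one]
      simp
    have hfin : ((t * l : ℝ≥0) : ℝ≥0∞)⁻¹ < ∞ :=
      ENNReal.inv_lt_top.2 (by exact_mod_cast mul_pos ht0 hl)
    suffices h : ∫⁻ ω, (Φ (t * l * ‖X ω‖₊) : ℝ≥0∞) ∂P ≤ 1 from
      lt_of_le_of_lt (iInf₂_le (f := fun (l : ℝ≥0)
        (_ : 0 < l ∧ ∫⁻ ω, (Φ (l * ‖X ω‖₊) : ℝ≥0∞) ∂P ≤ 1) => (l : ℝ≥0∞)⁻¹)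
        (t * l) ⟨mul_pos ht0 hl, h⟩) hfin
    calc ∫⁻ ω, (Φ (t * l * ‖X ω‖₊) : ℝ≥0∞) ∂P
        ≤ ∫⁻ ω, t * (Φ (l * ‖X ω‖₊) : ℝ≥0∞) ∂P := by
          refine lintegral_mono fun ω => ?_
          rw [mul_assoc, ← ENNReal.coe_mul, ENNReal.coe_le_coe]
          exact hΦ.map_mul_le ht1 _
      _ = t * c := by rw [lintegral_const_mul' _ _ ENNReal.coe_ne_top, ← hc]
      _ ≤ 1 := by exact_mod_cast htc

theorem IsOrliczFunction.mk_mem_orliczSpace (hΦ : IsOrliczFunction Φ) {l : ℝ≥0} (hl : 0 < l)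
    {Z : Ω → ℝ} (hZ : AEStronglyMeasurable Z P)
    (hint : Integrable (fun ω => scaledOrlicz Φ l |Z ω|) P) :
    AEEqFun.mk Z hZ ∈ OrliczSpace P Φ := by
  refine hΦ.mem_orliczSpace_iff.2 ⟨l, hl, hint.congr ?_⟩
  filter_upwards [AEEqFun.coeFn_mk Z hZ] with ω hω
  rw [hω]

/-- If a functional is order continuous, then it is continuous along almost surely convergent
sequences whose modulars, at a fixed scale, converge. -/
theorem OrderContinuous.tendsto_of_tendsto_integral (hΦ : IsOrliczFunction Φ)
    {ρ : OrliczSpace P Φ → ℝ} (hρ : OrderContinuous ρ) {l : ℝ≥0} (hl : 0 < l)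
    {Zs : ℕ → OrliczSpace P Φ} {Z : OrliczSpace P Φ}
    (hZs : ∀ n, Integrable (fun ω => scaledOrlicz Φ l |(Zs n).1 ω|) P)
    (hZ : Integrable (fun ω => scaledOrlicz Φ l |Z.1 ω|) P)
    (hlim : ∀ᵐ ω ∂P, Tendsto (fun n => (Zs n).1 ω) atTop (𝓝 (Z.1 ω)))
    (hint : Tendsto (fun n => ∫ ω, scaledOrlicz Φ l |(Zs n).1 ω| ∂P) atTop
      (𝓝 (∫ ω, scaledOrlicz Φ l |Z.1 ω| ∂P))) :
    Tendsto (fun n => ρ (Zs n)) atTop (𝓝 (ρ Z)) := by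
  have hcont := hΦ.continuous_scaledOrlicz l
  have hL1 := tendsto_integral_abs_sub_of_tendsto_integral hZs hZ
    (fun n => ae_of_all _ fun ω => scaledOrlicz_nonneg Φ l _)
    (hlim.mono fun ω hω => (hcont.tendsto _).comp hω.abs) hint
  refine tendsto_of_subseq_tendsto fun ns hns => ?_
  obtain ⟨ms, hms, G, hG, hdom⟩ :=
    exists_subseq_dominated (fun n => hZs (ns n)) hZ (hL1.comp hns)
  refine ⟨ms, hρ Z _ ⟨?_, ?_⟩⟩
  · filter_upwards [hlim] with ω hω
    exact hω.comp (hns.comp hms.tendsto_atTop)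
  · have hbdd : ∀ᵐ ω ∂P, BddAbove (Set.range fun k => |(Zs (ns (ms k))).1 ω|) := by
      filter_upwards [hlim] with ω hω
      exact (hω.comp (hns.comp hms.tendsto_atTop)).abs.bddAbove_range
    have hYm : AEStronglyMeasurable (fun ω => ⨆ k, |(Zs (ns (ms k))).1 ω|) P :=
      (AEMeasurable.iSup fun k => (Zs _).1.aemeasurable.abs).aestronglyMeasurable
    -- `Φ` is monotone and continuous, so it commutes with the supremum, and the bound `G` passes to
    -- it.
    have hYint : Integrable (fun ω => scaledOrlicz Φ l (abs (⨆ k, |(Zs (ns (ms k))).1 ω|))) P := by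
      refine hG.mono' ((hcont.comp continuous_abs).comp_aestronglyMeasurable hYm) ?_
      filter_upwards [hbdd, hdom] with ω h1 h2
      rw [Real.norm_of_nonneg (scaledOrlicz_nonneg Φ l _),
        abs_of_nonneg (Real.iSup_nonneg fun k => abs_nonneg _),
        (hΦ.monotone_scaledOrlicz l).map_ciSup_of_continuousAt hcont.continuousAt h1]
      exact ciSup_le h2
    refine ⟨⟨AEEqFun.mk _ hYm, hΦ.mk_mem_orliczSpace hl hYm hYint⟩, fun k => ?_⟩
    filter_upwards [AEEqFun.coeFn_mk _ hYm, hbdd] with ω h1 h2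
    rw [h1]
    exact le_ciSup h2 k

end Orlicz

/-! ### Integration against empirical laws -/

section EmpiricalLaw

variable {Ω : Type*} (Xs : ℕ → Ω → ℝ) (n : ℕ) (ω : Ω)

theorem isProbabilityMeasure_empiricalLaw [MeasurableSpace Ω] :
    IsProbabilityMeasure (empiricalLaw Xs (n + 1) ω) := by
  constructor
  simp only [empiricalLaw, Measure.smul_apply, Measure.finsetSum_apply, measure_univ, smul_eq_mul,
    Finset.sum_const, Finset.card_range, nsmul_eq_mul, mul_one]
  exact ENNReal.inv_mul_cancel (by simp) (ENNReal.natCast_ne_top _)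

theorem integrable_empiricalLaw {f : ℝ → ℝ} (hf : Measurable f) :
    Integrable f (empiricalLaw Xs (n + 1) ω) := by
  refine Integrable.smul_measure ?_ (by simp)
  refine integrable_finsetSum_measure.2 fun i _ => integrable_dirac' hf.stronglyMeasurable (by simp)

theorem integral_empiricalLaw {f : ℝ → ℝ} (hf : Measurable f) :
    ∫ x, f x ∂(empiricalLaw Xs n ω) = (n : ℝ)⁻¹ * ∑ i ∈ Finset.range n, f (Xs i ω) := by
  rw [empiricalLaw, integral_smul_measure, integral_finsetSum_measure]
  · simp [integral_dirac' _ _ hf.stronglyMeasurable]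
  · exact fun i _ => integrable_dirac' hf.stronglyMeasurable (by simp)

end EmpiricalLaw

/-! ### Realising laws in the Orlicz space by quantiles -/

section QuantileRepresentation

variable {Ω : Type*} [MeasurableSpace Ω] {P : Measure Ω} {U : Ω → ℝ}

theorem aemeasurable_quantile_comp (hU : Measurable U)
    (hUlaw : P.map U = volume.restrict (Set.Ioo 0 1)) (μ : Measure ℝ) :
    AEMeasurable (fun ω => quantile μ (U ω)) P :=
  (show AEMeasurable (quantile μ) (P.map U) from hUlaw ▸ aemeasurable_quantile μ).comp_measurable hU

theorem map_quantile_comp (hU : Measurable U)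
    (hUlaw : P.map U = volume.restrict (Set.Ioo 0 1)) (μ : Measure ℝ) [IsProbabilityMeasure μ] :
    P.map (fun ω => quantile μ (U ω)) = μ := by
  have hq : AEMeasurable (quantile μ) (P.map U) := hUlaw ▸ aemeasurable_quantile μ
  have h := AEMeasurable.map_map_of_aemeasurable hq hU.aemeasurable
  rw [hUlaw, map_quantile] at h
  exact h.symm

/-- A distribution on the line with a finite modular is the law of an element of the Orlicz space,
namely of its quantile function at a uniform random variable. -/
theorem IsOrliczFunction.exists_eq_quantile {Φ : ℝ≥0 → ℝ≥0} (hΦ : IsOrliczFunction Φ) {l : ℝ≥0}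
    (hl : 0 < l) (hU : Measurable U) (hUlaw : P.map U = volume.restrict (Set.Ioo 0 1))
    {μ : Measure ℝ} [IsProbabilityMeasure μ] (hμ : Integrable (fun x => scaledOrlicz Φ l |x|) μ) :
    ∃ Z : OrliczSpace P Φ, (Z.1 =ᵐ[P] fun ω => quantile μ (U ω)) ∧ P.map Z.1 = μ ∧
      Integrable (fun ω => scaledOrlicz Φ l |Z.1 ω|) P ∧
      ∫ ω, scaledOrlicz Φ l |Z.1 ω| ∂P = ∫ x, scaledOrlicz Φ l |x| ∂μ := by
  have hm := aemeasurable_quantile_comp hU hUlaw μ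
  have hmap := map_quantile_comp hU hUlaw μ
  have hcont : Continuous fun x : ℝ => scaledOrlicz Φ l |x| :=
    (hΦ.continuous_scaledOrlicz l).comp continuous_abs
  have hint : Integrable (fun ω => scaledOrlicz Φ l |quantile μ (U ω)|) P := by
    rw [← hmap] at hμ
    exact (integrable_map_measure hcont.aestronglyMeasurable hm).1 hμ
  have heq := AEEqFun.coeFn_mk (μ := P) _ hm.aestronglyMeasurable
  have hZmap : P.map (AEEqFun.mk (μ := P) _ hm.aestronglyMeasurable) = μ :=
    (Measure.map_congr heq).trans hmap
  refine ⟨⟨_, hΦ.mk_mem_orliczSpace hl hm.aestronglyMeasurable hint⟩, heq, hZmap, ?_, ?_⟩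
  · refine hint.congr ?_
    filter_upwards [heq] with ω hω
    rw [hω]
  · conv_rhs => rw [← hZmap]
    exact (integral_map (AEEqFun.aemeasurable _) hcont.aestronglyMeasurable).symm

end QuantileRepresentation

/-! ### Strong consistency -/

theorem theorem2 {Ω : Type*} [MeasurableSpace Ω] (P : Measure Ω) [IsProbabilityMeasure P]
    (hP : IsNonatomic P) (Φ : ℝ≥0 → ℝ≥0) (hΦ : IsOrliczFunction Φ)
    (ρ : OrliczSpace P Φ → ℝ) (hcont : OrderContinuous ρ) (hlaw : LawInvariant ρ)
    (X : OrliczSpace P Φ) :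
    StronglyConsistentAt ρ X := by
  intro Xs hXs hXlaw
  obtain ⟨U, hU, hUlaw⟩ := hP.exists_uniform
  obtain ⟨l, hl, hXint⟩ := hΦ.mem_orliczSpace_iff.1 X.2
  have hφ : Continuous fun x : ℝ => scaledOrlicz Φ l |x| :=
    (hΦ.continuous_scaledOrlicz l).comp continuous_abs
  have hXm : AEMeasurable X.1 P := X.1.aemeasurable
  have := Measure.isProbabilityMeasure_map (μ := P) hXm
  have hμint : Integrable (fun x => scaledOrlicz Φ l |x|) (P.map X.1) :=
    (integrable_map_measure hφ.aestronglyMeasurable hXm).2 hXint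
  have hX0int : Integrable (fun ω => scaledOrlicz Φ l |Xs 0 ω|) P := by
    rw [← hXlaw 0] at hμint
    exact (integrable_map_measure hφ.aestronglyMeasurable (hXs.measurable 0).aemeasurable).1 hμint
  have hX0 : ∀ f : ℝ → ℝ, Measurable f → ∫ ω, f (Xs 0 ω) ∂P = ∫ x, f x ∂(P.map X.1) :=
    fun f hf => by
      rw [← hXlaw 0, integral_map (hXs.measurable 0).aemeasurable hf.aestronglyMeasurable]
  have hprob := fun n ω => isProbabilityMeasure_empiricalLaw Xs n ω
  have hcdf : ∀ (ν : Measure ℝ) [IsProbabilityMeasure ν] (x : ℝ),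
      cdf ν x = ∫ y, (Set.Iic x).indicator (fun _ => (1 : ℝ)) y ∂ν := fun ν _ x => by
    rw [cdf_eq_real, integral_indicator_const _ measurableSet_Iic, smul_eq_mul, mul_one]
  -- All representatives use the same `U`; this coupling turns convergence of laws into almost sure
  -- convergence.
  choose Zs hZs_eq hZs_law hZs_int hZs_integral using fun n ω =>
    hΦ.exists_eq_quantile hl hU hUlaw (integrable_empiricalLaw Xs n ω hφ.measurable)
  obtain ⟨Z, hZ_eq, hZ_law, hZ_int, hZ_integral⟩ := hΦ.exists_eq_quantile hl hU hUlaw hμint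
  have hmem : ∀ n ω, empiricalLaw Xs (n + 1) ω ∈ lawsOf (OrliczSpace P Φ) :=
    fun n ω => ⟨Zs n ω, hZs_law n ω⟩
  refine ⟨hmem, ?_⟩
  have hind : ∀ q : ℚ, Measurable ((Set.Iic (q : ℝ)).indicator fun _ => (1 : ℝ)) := fun q =>
    measurable_const.indicator measurableSet_Iic
  have hslln := ae_all_iff.2 fun q : ℚ => hXs.ae_tendsto_average (hind q)
    (((integrable_const (1 : ℝ)).indicator measurableSet_Iic).comp_measurable (hXs.measurable 0))
  filter_upwards [hslln, hXs.ae_tendsto_average hφ.measurable hX0int] with ω hω hωφ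
  rw [hlaw X Z hZ_law.symm]
  refine Tendsto.congr (fun n => (inducedMap_law hlaw (Zs n ω) ⟨_, hmem n ω⟩ (hZs_law n ω)).symm) ?_
  refine hcont.tendsto_of_tendsto_integral hΦ hl (fun n => hZs_int n ω) hZ_int ?_ ?_
  · have hq := ae_tendsto_quantile (μs := fun n => empiricalLaw Xs (n + 1) ω) (μ := P.map X.1)
      fun q => by
        have h := hω q
        rw [hX0 _ (hind q), ← hcdf] at h
        refine ((tendsto_add_atTop_iff_nat 1).2 h).congr fun n => ?_
        rw [hcdf, integral_empiricalLaw _ _ _ (hind q)]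
    rw [← hUlaw] at hq
    -- Here `ω` is the fixed sample that determines the empirical laws, while `ω'` is the argument
    -- of the representing variables.
    filter_upwards [ae_of_ae_map hU.aemeasurable hq, ae_all_iff.2 fun n => hZs_eq n ω, hZ_eq]
      with ω' h1 h2 h3
    simp_rw [h2, h3]
    exact h1
  · rw [hX0 _ hφ.measurable, ← hZ_integral] at hωφ
    refine ((tendsto_add_atTop_iff_nat 1).2 hωφ).congr fun n => ?_
    rw [hZs_integral, integral_empiricalLaw _ _ _ hφ.measurable]
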